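/- Theorem (Anti-concentration). For a real random variable $\xi$ on a probability space and $\varepsilon>0$, let $\mathcal{L}(\xi,\varepsilon)=\sup_{x\in\mathbb{R}}\Pr(|\xi-x|\le\varepsilon)$ denote its Lévy concentration function. Let $p\ge 1$ and let $X_1,\dots,X_p$ be centered, jointly Gaussian (not necessarily independent) real random variables with $\sigma_j^2:=\mathbb{E}[X_j^2]>0$ (and $\sigma_j>0$) for all $1\le j\le p$. Put $\underline{\sigma}:=\min_{1\le j\le p}\sigma_j$, $\bar\sigma:=\max_{1\le j\le p}\sigma_j$ and $a_p:=\mathbb{E}[\max_{1\le j\le p}(X_j/\sigma_j)]$. (i) If the variances are all equal, $\underline{\sigma}=\bar\sigma=\sigma$, then for every $\varepsilon>0$, $$\mathcal{L}\Big(\max_{1\le j\le p}X_j,\varepsilon\Big)\le \frac{4\varepsilon(a_p+1)}{\sigma}.$$ (ii) If the variances are not all equal, $\underline{\sigma}<\bar\sigma$, then for every $\varepsilon>0$, $$\mathcal{L}\Big(\max_{1\le j\le p}X_j,\varepsilon\Big)\le C\,\varepsilon\Big\{a_p+\sqrt{\max\{1,\log(\underline{\sigma}/\varepsilon)\}}\Big\},$$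 where $C>0$ depends only on $\underline{\sigma}$ and $\bar\sigma$ (in particular, not on $p$, $\varepsilon$, the covariances of the $X_j$, or the probability space). -/

import Mathlib

open MeasureTheory ProbabilityTheory

universe u

noncomputable section

namespace GaussianMax

variable {Ω : Type u} [MeasurableSpace Ω]

/-- The Lévy concentration function `L(ξ, ε) = sup_{x ∈ ℝ} P(|ξ - x| ≤ ε)` of a real random
variable `ξ`. The supremum is over a family of real numbers in `[0, 1]` when `P` is a probability
measure. -/
def levyConcentration (P : Measure Ω) (ξ : Ω → ℝ) (ε : ℝ) : ℝ :=
  ⨆ x : ℝ, P.real {ω | |ξ ω - x| ≤ ε}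

/-- The maximum of finitely many (at least one) real numbers. -/
def maxOf {p : ℕ} [NeZero p] (a : Fin p → ℝ) : ℝ :=
  Finset.univ.sup' Finset.univ_nonempty a

/-- The minimum of finitely many (at least one) real numbers. -/
def minOf {p : ℕ} [NeZero p] (a : Fin p → ℝ) : ℝ :=
  Finset.univ.inf' Finset.univ_nonempty a

/-- `σ_j = (E[X_j²])^{1/2}`, the standard deviation of the `j`-th variable of a centered family. -/
def sd (P : Measure Ω) {p : ℕ} (X : Fin p → Ω → ℝ) (j : Fin p) : ℝ :=
  √(∫ ω, X j ω ^ 2 ∂P)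

/-- `a_p = E[max_j (X_j / σ_j)]`. -/
def expMax (P : Measure Ω) {p : ℕ} [NeZero p] (X : Fin p → Ω → ℝ) : ℝ :=
  ∫ ω, maxOf (fun j => X j ω / sd P X j) ∂P

/-- `X_1, …, X_p` are centered, jointly Gaussian (possibly dependent, possibly with a degenerate
joint law) random variables, each with positive variance. -/
structure IsCenteredGaussian (P : Measure Ω) {p : ℕ} (X : Fin p → Ω → ℝ) : Prop where
  jointlyGaussian : HasGaussianLaw (fun ω j => X j ω) P
  centered : ∀ j, ∫ ω, X j ω ∂P = 0
  variance_pos : ∀ j, 0 < ∫ ω, X j ω ^ 2 ∂P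

end GaussianMax

end

namespace GaussianMax

open Set Filter Topology
open scoped ENNReal

/-! For fixed `x`, pass to the unit variance variables `Z j = X j / σ_j` with means `m j = -x /
σ_j`; the event puts `max (m j + Z j)` within `ε / σmin` of zero. Split according to the first
maximiser `j` and regress every `Z i` on `Z j`. The residuals are independent of `Z j` and the
coefficients are at most one, so, given the residuals, `j` wins on an upper set `U` of values of `Z
j`. The standard normal density satisfies `φ s = ∫_s^∞ t φ t dt`, hence on `U` it is at most the
integral of `t⁺ φ t` over `U`. Summing over `j` bounds the density of the maximum by `E[(max Z)⁺] ≤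
a_p + 1`, whatever the means (`measure_maxOf_add_mem_Icc_le`). Both parts follow, with constant 2
and no logarithm. -/

/-! ### The Gaussian density against truncated first moments -/

lemma hasDerivAt_gaussianPDFReal_zero_one (t : ℝ) :
    HasDerivAt (fun t => -gaussianPDFReal 0 1 t) (t * gaussianPDFReal 0 1 t) t := by
  have h : HasDerivAt (fun t : ℝ => -(t - 0) ^ 2 / (2 * ((1 : NNReal) : ℝ))) (-t) t := by
    have := (((hasDerivAt_id t).sub_const 0).pow 2).neg.div_const (2 * ((1 : NNReal) : ℝ))
    exact this.congr_deriv (by simp; ring)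
  have h2 := (h.exp.const_mul ((√(2 * Real.pi * ((1 : NNReal) : ℝ)))⁻¹)).neg
  simp only [gaussianPDFReal_def]
  exact h2.congr_deriv (by ring)

lemma integrable_mul_gaussianPDFReal_zero_one :
    Integrable (fun t : ℝ => t * gaussianPDFReal 0 1 t) := by
  have := (integrable_mul_exp_neg_mul_sq (b := 1 / 2) (by norm_num)).const_mul
    ((√(2 * Real.pi * ((1 : NNReal) : ℝ)))⁻¹)
  refine this.congr (ae_of_all _ fun t => ?_)
  simp only [gaussianPDFReal_def, sub_zero, NNReal.coe_one, mul_one]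
  rw [show -t ^ 2 / 2 = -(1 / 2) * t ^ 2 by ring]
  ring

lemma tendsto_gaussianPDFReal_zero_one_atTop :
    Tendsto (fun t => -gaussianPDFReal 0 1 t) atTop (𝓝 0) := by
  have h : Tendsto (fun t : ℝ => -t ^ 2 / 2) atTop atBot :=
    (tendsto_neg_atTop_atBot.comp (tendsto_pow_atTop two_ne_zero)).atBot_div_const (by norm_num)
  have := ((Real.tendsto_exp_atBot.comp h).const_mul
    ((√(2 * Real.pi * ((1 : NNReal) : ℝ)))⁻¹)).neg
  simpa [gaussianPDFReal_def, Function.comp_def] using this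

/-- The standard Gaussian density at `s` is bounded by the truncated first moment on `(s, ∞)`. -/
lemma gaussianPDF_le_setLIntegral_Ioi (s : ℝ) :
    gaussianPDF 0 1 s ≤ ∫⁻ t in Ioi s, ENNReal.ofReal t ∂gaussianReal 0 1 := by
  have hint := integrable_mul_gaussianPDFReal_zero_one.integrableOn (s := Ioi s)
  have h := integral_Ioi_of_hasDerivAt_of_tendsto'
    (fun t _ => hasDerivAt_gaussianPDFReal_zero_one t) hint tendsto_gaussianPDFReal_zero_one_atTop
  rw [zero_sub, neg_neg] at h
  rw [gaussianReal_of_var_ne_zero 0 one_ne_zero,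
    setLIntegral_withDensity_eq_setLIntegral_mul _ (measurable_gaussianPDF 0 1)
      ENNReal.measurable_ofReal measurableSet_Ioi, gaussianPDF, ← h]
  rw [integral_eq_lintegral_pos_part_sub_lintegral_neg_part hint]
  -- `ENNReal.ofReal t` is the positive part, so for `s < 0` equality is lost by dropping the
  -- negative part.
  refine (ENNReal.ofReal_le_ofReal (sub_le_self _ ENNReal.toReal_nonneg)).trans
    (ENNReal.ofReal_toReal_le.trans (le_of_eq (lintegral_congr fun t => ?_)))
  rw [Pi.mul_apply, gaussianPDF, mul_comm, ENNReal.ofReal_mul (gaussianPDFReal_nonneg _ _ _)]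

/-- Each `s ∈ U` has `Ioi s ⊆ U`, so one constant bounds the density on all of `U`; integrating it
over the interval costs the length. -/
lemma gaussianReal_Icc_inter_isUpperSet_le {U : Set ℝ} (hU : IsUpperSet U) (a b : ℝ) :
    gaussianReal 0 1 (Icc a b ∩ U)
      ≤ ENNReal.ofReal (b - a) * ∫⁻ t in U, ENNReal.ofReal t ∂gaussianReal 0 1 := by
  have hm : MeasurableSet (Icc a b ∩ U) := measurableSet_Icc.inter hU.ordConnected.measurableSet
  rw [gaussianReal_apply 0 one_ne_zero]
  calc ∫⁻ s in Icc a b ∩ U, gaussianPDF 0 1 s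
      ≤ ∫⁻ _ in Icc a b ∩ U, ∫⁻ t in U, ENNReal.ofReal t ∂gaussianReal 0 1 := by
        refine setLIntegral_mono' hm fun s hs => (gaussianPDF_le_setLIntegral_Ioi s).trans ?_
        exact lintegral_mono_set fun t ht => hU (le_of_lt ht) hs.2
    _ ≤ _ := by
        rw [setLIntegral_const, mul_comm]
        gcongr
        exact (measure_mono inter_subset_left).trans_eq Real.volume_Icc

variable {Ω : Type u} [MeasurableSpace Ω] {P : Measure Ω} {p : ℕ}

/-! ### Regions where a given index wins -/

/-- The set of vectors `z` such that `j` is the first index maximising `i ↦ m i + z i`. -/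
def firstArgmax (m : Fin p → ℝ) (j : Fin p) : Set (Fin p → ℝ) :=
  {z | ∀ i, m i + z i ≤ m j + z j ∧ (i < j → m i + z i < m j + z j)}

lemma measurableSet_firstArgmax (m : Fin p → ℝ) (j : Fin p) :
    MeasurableSet (firstArgmax m j) := by
  have h : firstArgmax m j = ⋂ i, ({z | m i + z i ≤ m j + z j} ∩
      ⋂ _ : i < j, {z | m i + z i < m j + z j}) := by
    ext z
    simp [firstArgmax]
  rw [h]
  refine MeasurableSet.iInter fun i => MeasurableSet.inter ?_ (MeasurableSet.iInter fun _ => ?_)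
  · exact measurableSet_le (by fun_prop) (by fun_prop)
  · exact measurableSet_lt (by fun_prop) (by fun_prop)

lemma exists_mem_firstArgmax [NeZero p] (m z : Fin p → ℝ) : ∃ j, z ∈ firstArgmax m j := by
  classical
  obtain ⟨j₀, -, hj₀⟩ :=
    Finset.exists_max_image Finset.univ (fun i => m i + z i) Finset.univ_nonempty
  let s := Finset.univ.filter fun j => ∀ i, m i + z i ≤ m j + z j
  have hs : s.Nonempty := ⟨j₀, by simpa [s] using hj₀⟩
  have hmem : ∀ i, m i + z i ≤ m (s.min' hs) + z (s.min' hs) := by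
    simpa [s] using s.min'_mem hs
  refine ⟨s.min' hs, fun i => ⟨hmem i, fun hi => lt_of_not_ge fun hle => ?_⟩⟩
  have : i ∈ s := by simpa [s] using fun k => (hmem k).trans hle
  exact absurd (s.min'_le i this) (not_le.2 hi)

/-- Breaking ties by index prevents double counting when a degenerate joint law gives ties positive
probability. -/
lemma pairwise_disjoint_firstArgmax (m : Fin p → ℝ) :
    Pairwise (Function.onFun Disjoint (firstArgmax m)) := by
  intro j k hjk
  refine Set.disjoint_left.2 fun z hj hk => ?_
  rcases lt_or_gt_of_ne hjk with h | h
  · exact absurd ((hk j).2 h) (not_lt.2 (hj k).1)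
  · exact absurd ((hj k).2 h) (not_lt.2 (hk j).1)

/-- With the residuals `r` fixed, the event that `j` is the first maximiser is increasing in the
value `t` of the `j`-th coordinate when all regression coefficients are at most one. -/
lemma isUpperSet_firstArgmax_residual (m r ρ : Fin p → ℝ) (j : Fin p) (hρ : ∀ i, ρ i ≤ 1)
    (hρj : ρ j = 1) :
    IsUpperSet {t : ℝ | (fun i => r i + ρ i * t) ∈ firstArgmax m j} := by
  intro t t' htt h i
  have h1 : ρ i * (t' - t) ≤ t' - t := mul_le_of_le_one_left (sub_nonneg.2 htt) (hρ i)
  have h2 := h i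
  simp only [hρj, one_mul] at h2 ⊢
  exact ⟨by linarith [h2.1], fun hi => by linarith [h2.2 hi]⟩

/-- With unit variances `E[Z i * Z j]` is the regression coefficient, so the residuals are
uncorrelated with `Z j`, hence independent of it by joint Gaussianity. -/
lemma indepFun_residual [IsProbabilityMeasure P] {Z : Fin p → Ω → ℝ}
    (hZ : HasGaussianLaw (fun ω i => Z i ω) P) (h0 : ∀ i, ∫ ω, Z i ω ∂P = 0)
    (h1 : ∀ i, ∫ ω, Z i ω ^ 2 ∂P = 1) (j : Fin p) :
    IndepFun (Z j) (fun ω i => Z i ω - (∫ ω, Z i ω * Z j ω ∂P) * Z j ω) P := by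
  have hL2 : ∀ i, MemLp (Z i) 2 P := fun i => (hZ.eval i).memLp_two
  have hg : HasGaussianLaw (fun ω => (fun _ : Unit => Z j ω,
      fun i => Z i ω - (∫ ω, Z i ω * Z j ω ∂P) * Z j ω)) P :=
    (hZ.map_fun (E := Fin p → ℝ) (F := (Unit → ℝ) × (Fin p → ℝ))
      ((ContinuousLinearMap.pi fun _ : Unit => ContinuousLinearMap.proj (φ := fun _ => ℝ) j).prod
      (ContinuousLinearMap.pi fun i => ContinuousLinearMap.proj (φ := fun _ => ℝ) i -
        (∫ ω, Z i ω * Z j ω ∂P) • ContinuousLinearMap.proj (φ := fun _ => ℝ) j))).congr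
      (ae_of_all _ fun ω => Prod.ext (by ext; simp) (by ext; simp))
  have hind := hg.indepFun_of_covariance_eval (X := fun _ : Unit => Z j)
    (Y := fun i ω => Z i ω - (∫ ω, Z i ω * Z j ω ∂P) * Z j ω) fun _ i => by
      have hcov : ∀ k, cov[Z j, Z k; P] = ∫ ω, Z k ω * Z j ω ∂P := fun k => by
        rw [covariance_eq_sub (hL2 j) (hL2 k), h0, h0]
        simp [mul_comm]
      rw [covariance_fun_sub_right (hL2 j) (hL2 i) ((hL2 j).const_mul _),
        covariance_const_mul_right, hcov, hcov]
      simp_rw [← pow_two]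
      rw [h1]
      ring
  exact hind.comp (measurable_pi_apply ()) measurable_id

lemma integral_mul_le_one {f g : Ω → ℝ} (hf : MemLp f 2 P) (hg : MemLp g 2 P)
    (hf1 : ∫ ω, f ω ^ 2 ∂P = 1) (hg1 : ∫ ω, g ω ^ 2 ∂P = 1) : ∫ ω, f ω * g ω ∂P ≤ 1 := by
  calc ∫ ω, f ω * g ω ∂P ≤ ∫ ω, (f ω ^ 2 + g ω ^ 2) / 2 ∂P := by
        refine integral_mono (hf.integrable_mul hg)
          ((hf.integrable_sq.add hg.integrable_sq).div_const 2) fun ω => ?_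
        have := two_mul_le_add_sq (f ω) (g ω)
        simp only
        linarith
    _ = 1 := by
        rw [integral_div, integral_add hf.integrable_sq hg.integrable_sq, hf1, hg1]
        norm_num

lemma map_eq_gaussianReal_zero_one [IsProbabilityMeasure P] {Y : Ω → ℝ}
    (hY : HasGaussianLaw Y P) (h0 : ∫ ω, Y ω ∂P = 0) (h1 : ∫ ω, Y ω ^ 2 ∂P = 1) :
    P.map Y = gaussianReal 0 1 := by
  rw [hY.map_eq_gaussianReal, h0, variance_of_integral_eq_zero hY.aemeasurable h0, h1,
    Real.toNNReal_one]

/-- The part of the law of the `j`-th coordinate on which `j` is the first maximiser has a density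
bounded by its truncated first moment. -/
lemma measure_Icc_inter_firstArgmax_le [IsProbabilityMeasure P] {Z : Fin p → Ω → ℝ}
    (hZ : HasGaussianLaw (fun ω i => Z i ω) P) (h0 : ∀ i, ∫ ω, Z i ω ∂P = 0)
    (h1 : ∀ i, ∫ ω, Z i ω ^ 2 ∂P = 1) (m : Fin p → ℝ) (j : Fin p) (a b : ℝ) :
    P.map (fun ω i => Z i ω) ({z | z j ∈ Icc a b} ∩ firstArgmax m j)
      ≤ ENNReal.ofReal (b - a) *
        ∫⁻ z in firstArgmax m j, ENNReal.ofReal (z j) ∂P.map (fun ω i => Z i ω) := by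
  have hL2 : ∀ i, MemLp (Z i) 2 P := fun i => (hZ.eval i).memLp_two
  set ρ : Fin p → ℝ := fun i => ∫ ω, Z i ω * Z j ω ∂P with hρdef
  have hρ : ∀ i, ρ i ≤ 1 := fun i => integral_mul_le_one (hL2 i) (hL2 j) (h1 i) (h1 j)
  have hρj : ρ j = 1 := by simp only [hρdef, ← pow_two, h1]
  have hZm : ∀ i, AEMeasurable (Z i) P := fun i => (hZ.eval i).aemeasurable
  have hRm : AEMeasurable (fun ω i => Z i ω - ρ i * Z j ω) P :=
    aemeasurable_pi_lambda _ fun i => (hZm i).sub ((hZm j).const_mul _)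
  set Q : Measure (Fin p → ℝ) := P.map (fun ω i => Z i ω - ρ i * Z j ω)
  have hprod : P.map (fun ω => (Z j ω, fun i => Z i ω - ρ i * Z j ω))
      = (gaussianReal 0 1).prod Q := by
    rw [← map_eq_gaussianReal_zero_one (hZ.eval j) (h0 j) (h1 j)]
    exact (indepFun_iff_map_prod_eq_prod_map_map (hZm j) hRm).1 (indepFun_residual hZ h0 h1 j)
  have : IsProbabilityMeasure Q := Measure.isProbabilityMeasure_map hRm
  -- `T` rebuilds the vector from `Z j` and the residuals, so the claim can be checked on slices
  -- with fixed residuals.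
  let T : ℝ × (Fin p → ℝ) → Fin p → ℝ := fun q i => q.2 i + ρ i * q.1
  have hT : Measurable T := by fun_prop
  have hν : P.map (fun ω i => Z i ω) = ((gaussianReal 0 1).prod Q).map T := by
    rw [← hprod, AEMeasurable.map_map_of_aemeasurable hT.aemeasurable ((hZm j).prodMk hRm)]
    congr 1
    ext ω i
    simp [T]
  rw [hν]
  let U : (Fin p → ℝ) → Set ℝ := fun r => {t | T (t, r) ∈ firstArgmax m j}
  have hU : ∀ r, IsUpperSet (U r) := fun r => isUpperSet_firstArgmax_residual m r ρ j hρ hρj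
  have hJ := measurableSet_firstArgmax m j
  have hI : MeasurableSet ({z : Fin p → ℝ | z j ∈ Icc a b} ∩ firstArgmax m j) :=
    (measurableSet_Icc.preimage (measurable_pi_apply j)).inter hJ
  have hTr : ∀ r, Measurable fun t => T (t, r) := fun r => by fun_prop
  have hf : Measurable fun z : Fin p → ℝ => ENNReal.ofReal (z j) := by fun_prop
  have hTj : ∀ q, T q j = q.2 j + q.1 := fun q => by simp [T, hρj]
  -- the residual of the `j`-th coordinate vanishes
  have hQj : ∀ᵐ r ∂Q, r j = 0 := by
    refine (ae_map_iff hRm (measurableSet_eq_fun (by fun_prop) (by fun_prop))).2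
      (ae_of_all _ fun ω => ?_)
    simp [hρj]
  have hfT : AEMeasurable ((T ⁻¹' firstArgmax m j).indicator fun q => ENNReal.ofReal (T q j))
      ((gaussianReal 0 1).prod Q) := ((hf.comp hT).indicator (hT hJ)).aemeasurable
  rw [Measure.map_apply hT hI, Measure.prod_apply_symm (hT hI), setLIntegral_map hJ hf hT,
    ← lintegral_indicator (hT hJ), lintegral_prod_symm _ hfT,
    ← lintegral_const_mul' _ _ ENNReal.ofReal_ne_top]
  refine lintegral_mono_ae (hQj.mono fun r hr => ?_)
  refine (le_of_eq ?_).trans ((gaussianReal_Icc_inter_isUpperSet_le (hU r) a b).trans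
    (le_of_eq ?_))
  · congr 1
    ext t
    simp [U, hTj, hr]
  · rw [← lintegral_indicator (show MeasurableSet (U r) from hTr r hJ)]
    congr 2
    ext t
    simp only [U, Set.indicator, hTj, hr, zero_add]
    rfl

/-! ### Density bound for the maximum -/

lemma le_maxOf [NeZero p] (z : Fin p → ℝ) (j : Fin p) : z j ≤ maxOf z :=
  Finset.le_sup' z (Finset.mem_univ j)

lemma exists_eq_maxOf [NeZero p] (z : Fin p → ℝ) : ∃ j, z j = maxOf z := by
  obtain ⟨j, -, hj⟩ := Finset.exists_mem_eq_sup' (Finset.univ_nonempty (α := Fin p)) z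
  exact ⟨j, hj.symm⟩

lemma continuous_maxOf [NeZero p] : Continuous (maxOf : (Fin p → ℝ) → ℝ) :=
  Continuous.finset_sup'_apply Finset.univ_nonempty fun i _ => continuous_apply i

lemma abs_maxOf_le [NeZero p] (z : Fin p → ℝ) : |maxOf z| ≤ ∑ i, |z i| := by
  obtain ⟨j, hj⟩ := exists_eq_maxOf z
  rw [← hj]
  exact Finset.single_le_sum (f := fun i => |z i|) (fun i _ => abs_nonneg _) (Finset.mem_univ j)

lemma integrable_maxOf [NeZero p] {Z : Fin p → Ω → ℝ} (hZ : ∀ i, Integrable (Z i) P) :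
    Integrable (fun ω => maxOf fun i => Z i ω) P := by
  refine (integrable_finsetSum Finset.univ fun i _ => (hZ i).abs).mono'
    (continuous_maxOf.comp_aestronglyMeasurable
      (aemeasurable_pi_lambda _ fun i => (hZ i).aemeasurable).aestronglyMeasurable)
    (ae_of_all _ fun ω => abs_maxOf_le _)

lemma lintegral_ofReal_maxOf_le [NeZero p] [IsProbabilityMeasure P] {Z : Fin p → Ω → ℝ}
    (hL2 : ∀ i, MemLp (Z i) 2 P) (h1 : ∀ i, ∫ ω, Z i ω ^ 2 ∂P = 1) :
    ∫⁻ ω, ENNReal.ofReal (maxOf fun i => Z i ω) ∂P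
      ≤ ENNReal.ofReal (∫ ω, (maxOf fun i => Z i ω) ∂P + 1) := by
  have hM := integrable_maxOf fun i => (hL2 i).integrable one_le_two
  -- This function has mean one and dominates `-Z 0`, hence the negative part of the maximum.
  have hQ : Integrable (fun ω => (1 + Z 0 ω ^ 2) / 2) P :=
    ((integrable_const 1).add (hL2 0).integrable_sq).div_const 2
  have hQ1 : ∫ ω, (1 + Z 0 ω ^ 2) / 2 ∂P = 1 := by
    rw [integral_div, integral_add (integrable_const 1) (hL2 0).integrable_sq, h1]
    norm_num
  rw [← hQ1, ← integral_add hM hQ, ofReal_integral_eq_lintegral_ofReal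
    (f := fun ω => (maxOf fun i => Z i ω) + (1 + Z 0 ω ^ 2) / 2) (hM.add hQ)]
  · refine lintegral_mono fun ω => ENNReal.ofReal_le_ofReal ?_
    have := sq_nonneg (Z 0 ω)
    linarith
  · refine ae_of_all _ fun ω => ?_
    have := le_maxOf (fun i => Z i ω) 0
    simp only [Pi.zero_apply]
    nlinarith [sq_nonneg (Z 0 ω + 1)]

/-- The maximum of jointly Gaussian variables of unit variance and arbitrary means `m i` has a
density bounded by the mean of the positive part of the maximum of the centered variables. -/
lemma measure_maxOf_add_mem_Icc_le [NeZero p] [IsProbabilityMeasure P] {Z : Fin p → Ω → ℝ}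
    (hZ : HasGaussianLaw (fun ω i => Z i ω) P) (h0 : ∀ i, ∫ ω, Z i ω ∂P = 0)
    (h1 : ∀ i, ∫ ω, Z i ω ^ 2 ∂P = 1) (m : Fin p → ℝ) (a b : ℝ) :
    P {ω | (maxOf fun i => m i + Z i ω) ∈ Icc a b}
      ≤ ENNReal.ofReal (b - a) * ∫⁻ ω, ENNReal.ofReal (maxOf fun i => Z i ω) ∂P := by
  have hZm : AEMeasurable (fun ω i => Z i ω) P := hZ.aemeasurable
  set ν := P.map (fun ω i => Z i ω) with hν
  have hmax : Measurable fun z : Fin p → ℝ => maxOf fun i => m i + z i :=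
    (continuous_maxOf.comp (by fun_prop)).measurable
  have hmap : P {ω | (maxOf fun i => m i + Z i ω) ∈ Icc a b}
      = ν {z | (maxOf fun i => m i + z i) ∈ Icc a b} :=
    (Measure.map_apply_of_aemeasurable hZm (hmax measurableSet_Icc)).symm
  have hlint : ∫⁻ ω, ENNReal.ofReal (maxOf fun i => Z i ω) ∂P
      = ∫⁻ z, ENNReal.ofReal (maxOf z) ∂ν :=
    (lintegral_map' (continuous_maxOf.measurable.ennreal_ofReal).aemeasurable hZm).symm
  have hcover : {z : Fin p → ℝ | (maxOf fun i => m i + z i) ∈ Icc a b}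
      ⊆ ⋃ j, ({z | z j ∈ Icc (a - m j) (b - m j)} ∩ firstArgmax m j) := by
    intro z hz
    obtain ⟨j, hj⟩ := exists_mem_firstArgmax m z
    have hmj : (maxOf fun i => m i + z i) = m j + z j :=
      le_antisymm (Finset.sup'_le _ _ fun i _ => (hj i).1) (le_maxOf (fun i => m i + z i) j)
    rw [mem_ofPred_eq, hmj] at hz
    exact mem_iUnion.2 ⟨j, ⟨by linarith [hz.1], by linarith [hz.2]⟩, hj⟩
  rw [hmap, hlint]
  calc ν {z | (maxOf fun i => m i + z i) ∈ Icc a b}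
      ≤ ∑ j, ν ({z | z j ∈ Icc (a - m j) (b - m j)} ∩ firstArgmax m j) :=
        (measure_mono hcover).trans (measure_iUnion_fintype_le _ _)
    _ ≤ ∑ j, ENNReal.ofReal (b - a) * ∫⁻ z in firstArgmax m j, ENNReal.ofReal (maxOf z) ∂ν := by
        refine Finset.sum_le_sum fun j _ =>
          (measure_Icc_inter_firstArgmax_le hZ h0 h1 m j _ _).trans ?_
        -- The shift by `m j` preserves the interval length, so the means leave the bound.
        rw [sub_sub_sub_cancel_right]
        gcongr with z
        exact le_maxOf z j
    _ = ENNReal.ofReal (b - a) * ∫⁻ z in ⋃ j, firstArgmax m j, ENNReal.ofReal (maxOf z) ∂ν := by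
        rw [← Finset.mul_sum, lintegral_iUnion (measurableSet_firstArgmax m)
          (pairwise_disjoint_firstArgmax m), tsum_fintype]
    _ ≤ _ := by
        gcongr
        exact Measure.restrict_le_self

/-- Subtracting `x` before rescaling centres the window at zero, where unequal scales only shrink it
to within `ε / σ`. The lower bound uses only the index attaining `maxOf y`. -/
lemma maxOf_div_sub_div_mem_Icc [NeZero p] {y s : Fin p → ℝ} {σ ε x : ℝ} (hσ : 0 < σ)
    (hs : ∀ j, σ ≤ s j) (hε : 0 ≤ ε) (h : |maxOf y - x| ≤ ε) :
    (maxOf fun j => -x / s j + y j / s j) ∈ Icc (-(ε / σ)) (ε / σ) := by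
  obtain ⟨h1, h2⟩ := abs_le.1 h
  have hdiv : ∀ j, ε / s j ≤ ε / σ := fun j => div_le_div_of_nonneg_left hε hσ (hs j)
  have hspos : ∀ j, 0 < s j := fun j => hσ.trans_le (hs j)
  constructor
  · obtain ⟨j, hj⟩ := exists_eq_maxOf y
    refine le_trans ?_ (le_maxOf _ j)
    rw [← add_div]
    have : -ε / s j ≤ (-x + y j) / s j :=
      div_le_div_of_nonneg_right (by linarith) (hspos j).le
    rw [neg_div] at this
    linarith [hdiv j]
  · refine Finset.sup'_le _ _ fun j _ => ?_
    rw [← add_div]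
    refine le_trans ?_ (hdiv j)
    exact div_le_div_of_nonneg_right (by linarith [le_maxOf y j]) (hspos j).le

section Centered

variable {X : Fin p → Ω → ℝ}

lemma IsCenteredGaussian.sd_pos (hX : IsCenteredGaussian P X) (j : Fin p) : 0 < sd P X j :=
  Real.sqrt_pos.2 (hX.variance_pos j)

lemma IsCenteredGaussian.hasGaussianLaw_div_sd (hX : IsCenteredGaussian P X) :
    HasGaussianLaw (fun ω j => X j ω / sd P X j) P := by
  have h := hX.jointlyGaussian.map_fun (E := Fin p → ℝ) (F := Fin p → ℝ)
    (ContinuousLinearMap.pi fun j => (sd P X j)⁻¹ •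
      ContinuousLinearMap.proj (φ := fun _ => ℝ) j)
  simpa [div_eq_inv_mul] using h

lemma IsCenteredGaussian.integral_div_sd (hX : IsCenteredGaussian P X) (j : Fin p) :
    ∫ ω, X j ω / sd P X j ∂P = 0 := by
  rw [integral_div, hX.centered, zero_div]

lemma IsCenteredGaussian.integral_div_sd_sq (hX : IsCenteredGaussian P X) (j : Fin p) :
    ∫ ω, (X j ω / sd P X j) ^ 2 ∂P = 1 := by
  simp_rw [div_pow]
  rw [integral_div, sd, Real.sq_sqrt (hX.variance_pos j).le, div_self (hX.variance_pos j).ne']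

variable [NeZero p]

lemma IsCenteredGaussian.expMax_nonneg (hX : IsCenteredGaussian P X) : 0 ≤ expMax P X := by
  have hint : ∀ i, Integrable (fun ω => X i ω / sd P X i) P := fun i =>
    (hX.hasGaussianLaw_div_sd.eval i).integrable
  rw [← hX.integral_div_sd 0]
  exact integral_mono (hint 0) (integrable_maxOf hint)
    fun ω => le_maxOf (fun i => X i ω / sd P X i) 0

/-- Anti-concentration of the maximum of a centered Gaussian vector whose standard deviations are
all at least `σ`. No upper bound on the standard deviations is needed: for fixed `x` the event
`|max X_j - x| ≤ ε` is contained in the event that the maximum of the unit variance variables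
`(X_j - x) / σ_j` lies within `ε / σ` of zero, and the density of that maximum is bounded by
`expMax P X + 1` whatever the means are. -/
theorem IsCenteredGaussian.levyConcentration_maxOf_le [IsProbabilityMeasure P]
    (hX : IsCenteredGaussian P X) {σ ε : ℝ}
    (hσ : 0 < σ) (hs : ∀ j, σ ≤ sd P X j) (hε : 0 ≤ ε) :
    levyConcentration P (fun ω => maxOf fun j => X j ω) ε ≤ 2 * ε * (expMax P X + 1) / σ := by
  have ha := hX.expMax_nonneg
  refine ciSup_le fun x => ENNReal.toReal_le_of_le_ofReal (by positivity) ?_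
  have hZ := hX.hasGaussianLaw_div_sd
  have hL2 : ∀ i, MemLp (fun ω => X i ω / sd P X i) 2 P := fun i => (hZ.eval i).memLp_two
  calc P {ω | |(maxOf fun j => X j ω) - x| ≤ ε}
      ≤ P {ω | (maxOf fun j => -x / sd P X j + X j ω / sd P X j) ∈ Icc (-(ε / σ)) (ε / σ)} :=
        measure_mono fun ω hω => maxOf_div_sub_div_mem_Icc hσ hs hε hω
    _ ≤ ENNReal.ofReal (ε / σ - -(ε / σ)) *
          ∫⁻ ω, ENNReal.ofReal (maxOf fun i => X i ω / sd P X i) ∂P :=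
        measure_maxOf_add_mem_Icc_le hZ hX.integral_div_sd hX.integral_div_sd_sq _ _ _
    _ ≤ ENNReal.ofReal (ε / σ - -(ε / σ)) * ENNReal.ofReal (expMax P X + 1) := by
        gcongr
        exact lintegral_ofReal_maxOf_le hL2 hX.integral_div_sd_sq
    _ = ENNReal.ofReal (2 * ε * (expMax P X + 1) / σ) := by
        rw [← ENNReal.ofReal_mul' (by positivity)]
        congr 1
        ring

end Centered

end GaussianMax

theorem mainTheorem1 :
    -- (i) all variances are equal to `σ ^ 2`
    (∀ (p : ℕ) [NeZero p] (Ω : Type u) [MeasurableSpace Ω] (P : Measure Ω)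
        [IsProbabilityMeasure P] (X : Fin p → Ω → ℝ),
        GaussianMax.IsCenteredGaussian P X →
        ∀ σ : ℝ, (∀ j, GaussianMax.sd P X j = σ) →
        ∀ ε : ℝ, 0 < ε →
          GaussianMax.levyConcentration P (fun ω => GaussianMax.maxOf fun j => X j ω) ε
            ≤ 4 * ε * (GaussianMax.expMax P X + 1) / σ) ∧
    -- (ii) the variances are not all equal; `C` depends only on the two extreme values
    (∀ σmin σmax : ℝ, 0 < σmin → σmin < σmax →
      ∃ C : ℝ, 0 < C ∧
        ∀ (p : ℕ) [NeZero p] (Ω : Type u) [MeasurableSpace Ω] (P : Measure Ω)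
          [IsProbabilityMeasure P] (X : Fin p → Ω → ℝ),
          GaussianMax.IsCenteredGaussian P X →
          GaussianMax.minOf (GaussianMax.sd P X) = σmin →
          GaussianMax.maxOf (GaussianMax.sd P X) = σmax →
          ∀ ε : ℝ, 0 < ε →
            GaussianMax.levyConcentration P (fun ω => GaussianMax.maxOf fun j => X j ω) ε
              ≤ C * ε * (GaussianMax.expMax P X + √(max 1 (Real.log (σmin / ε))))) := by
  refine ⟨fun p _ Ω _ P _ X hX σ hσ ε hε => ?_, fun σmin σmax hmin _ => ⟨2 / σmin, by positivity,
    fun p _ Ω _ P _ X hX hXmin _ ε hε => ?_⟩⟩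
  · have hσpos : 0 < σ := hσ 0 ▸ hX.sd_pos 0
    have ha := hX.expMax_nonneg
    refine (hX.levyConcentration_maxOf_le hσpos (fun j => (hσ j).ge) hε.le).trans ?_
    gcongr
    norm_num
  · have ha := hX.expMax_nonneg
    have hs : ∀ j, σmin ≤ GaussianMax.sd P X j := fun j =>
      hXmin ▸ Finset.inf'_le (GaussianMax.sd P X) (Finset.mem_univ j)
    refine (hX.levyConcentration_maxOf_le hmin hs hε.le).trans ?_
    -- The logarithmic factor serves only as an upper bound for the summand 1, so `C = 2 / σmin`
    -- suffices.
    have hL : 1 ≤ √(max 1 (Real.log (σmin / ε))) := Real.one_le_sqrt.2 (le_max_left _ _)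
    rw [show 2 * ε * (GaussianMax.expMax P X + 1) / σmin
      = 2 / σmin * ε * (GaussianMax.expMax P X + 1) by ring]
    gcongr
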